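/- Let $K$ be a function field of transcendence degree one over a finite field $\mathbb{F}_q$ (that is, $K$ is a finite extension of a field $\mathbb{F}_q(T)$ of rational functions), and assume that $\mathbb{F}_q$ is the full field of constants of $K$ (it is algebraically closed in $K$); $K$ is the field of functions on a curve $\mathcal{C}$ over $\mathbb{F}_q$. For a valuation $v$ of $K$, i.e. a discrete valuation that is trivial on $\mathbb{F}_q$ and normalized to have value group $\mathbb{Z}$, let $\deg v$ be the degree over $\mathbb{F}_q$ of its residue class field. A divisor is a finite formal sum $\mathcal{D}=\sum_v\mathcal{D}_v v$ with $\mathcal{D}_v\in\mathbb{Z}$, its degree is $\deg\mathcal{D}=\sum_v\mathcal{D}_v\deg v$, and two divisors are linearly equivalent if their difference is the divisor $(\alpha)=\sum_v v(\alpha)v$ of some function $\alpha\in K^*$. For $n\in\mathbb{Z}$ let $\mathrm{Pic}(n)$ be the set of linear equivalence classes of divisors of degree $n$. Theorem. For every $n\in\mathbb{Z}$ the set $\mathrm{Pic}(n)$ is finite. In particular, the class number $h=|\mathrm{Pic}(0)|$ is finite. -/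

import Mathlib

open scoped WithZero RatFunc

noncomputable section

namespace FunctionFieldCurve

variable (F K : Type*) [Field F] [Field K] [Algebra F K]

/-- A valuation of the function field `K` (a closed point of the curve over `F`): a discrete
valuation of `K`, trivial on the constants `F`, and normalized so that its value group is all
of `ℤ`. -/
@[ext]
structure Place where
  /-- the valuation, written multiplicatively -/
  valuation : Valuation K ℤᵐ⁰
  trivialOn : valuation.IsTrivialOn F
  normalized : Function.Surjective valuation

variable {F K}

namespace Place

/-- The ring `𝓞_v` of functions that are regular at `v`. -/
abbrev integers (v : Place F K) : ValuationSubring K := v.valuation.valuationSubring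

/-- The constants are regular at every place. -/
instance (v : Place F K) : Algebra F v.integers :=
  ((algebraMap F K).codRestrict v.integers.toSubring fun a => by
    have := v.trivialOn
    exact Valuation.IsTrivialOn.valuation_algebraMap_le_one (v := v.valuation) a).toAlgebra

/-- The residue class field `K(v)`; it is an algebra over `F`. -/
abbrev residueField (v : Place F K) : Type _ := IsLocalRing.ResidueField v.integers

/-- The degree of `v`: the degree over `F` of the residue class field. -/
def deg (v : Place F K) : ℕ := Module.finrank F v.residueField

/-- The order of vanishing `v(α) ∈ ℤ` of a function `α ≠ 0` (additive notation, so that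
`v(π) = 1` for a uniformizer `π`; the junk value at `α = 0` is never used). -/
def ord (v : Place F K) (α : K) : ℤ := -WithZero.log (v.valuation α)

end Place

variable (F K) in
/-- Divisors: finite formal sums `∑ D_v v` with integer coefficients. -/
abbrev Divisor : Type _ := Place F K →₀ ℤ

/-- The degree `∑ D_v deg v` of a divisor. -/
def Divisor.deg (D : Divisor F K) : ℤ := D.sum fun v n => n * (v.deg : ℤ)

variable (F K)

/-- The principal divisors `(α) = ∑ v(α) v`, for `α ∈ K*`. -/
def principalDivisors : AddSubgroup (Divisor F K) where
  carrier := {D | ∃ α : K, α ≠ 0 ∧ ∀ v : Place F K, D v = v.ord α}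
  zero_mem' := ⟨1, one_ne_zero, fun v => by simp [Place.ord]⟩
  add_mem' := by
    rintro D E ⟨α, hα, hD⟩ ⟨β, hβ, hE⟩
    refine ⟨α * β, mul_ne_zero hα hβ, fun v => ?_⟩
    have h1 : v.valuation α ≠ 0 := (Valuation.ne_zero_iff _).2 hα
    have h2 : v.valuation β ≠ 0 := (Valuation.ne_zero_iff _).2 hβ
    rw [Finsupp.add_apply, hD, hE, Place.ord, Place.ord, Place.ord, map_mul,
      WithZero.log_mul h1 h2]
    ring
  neg_mem' := by
    rintro D ⟨α, hα, hD⟩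
    refine ⟨α⁻¹, inv_ne_zero hα, fun v => ?_⟩
    rw [Finsupp.neg_apply, hD, Place.ord, Place.ord, map_inv₀, WithZero.log_inv]

/-- The group of linear equivalence classes of divisors: `D` and `D'` have the same class if and
only if `D - D'` is the divisor of a function. -/
abbrev DivisorClass : Type _ := Divisor F K ⧸ principalDivisors F K

/-- `Pic(n)`: the set of linear equivalence classes of divisors of degree `n`. -/
def Pic (n : ℤ) : Set (DivisorClass F K) :=
  {c | ∃ D : Divisor F K, D.deg = n ∧ (QuotientAddGroup.mk D : DivisorClass F K) = c}

/-- The class number `h = |Pic(0)|`, a priori possibly infinite. -/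
def classNumber : ℕ∞ := (Pic F K 0).encard

end FunctionFieldCurve

end

/-! Write q = |F|. After translation by a multiple of a fixed place, every class of degree n
contains an effective divisor (`exists_effective_of_deg_ge`), and effective divisors of a given
degree are finite in number (`finite_effective`), because off the poles of a transcendental T every
place of degree m is a zero of T^(q^m) - T.

The first fact is a weak Riemann inequality, obtained by counting: over a finite field, dimensions
are read off from indices of additive groups. Allowing one more pole at v enlarges a space of
functions by at most the residue field of v, and by exactly that if only finitely many places are
constrained (weak approximation). Together with the bound [K : F(z)] for the dimension of M / zM
(`relIndex_mul_le`), this gives deg (zeros of z) ≤ [K : F(z)]. The products z^j u_i, with u_i a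
basis of K over F(z), give the reverse inequality (`deg_zeros`), so principal divisors have degree
0, and they make the spaces L(lP) large, P being the polar divisor of z.

Enough places exist because the same index bound forces a valuation ring that omits z to be discrete
(`exists_one_lt_valuation`). -/

open WithZero

noncomputable section

namespace FunctionFieldCurve

variable {F K : Type*} [Field F] [Field K] [Algebra F K]

/-! ### Finiteness over F(z) and the index bound -/

/-- A function field of one variable is finite over the field generated by any of its
transcendental elements. -/
theorem finiteDimensional_adjoin_of_transcendental [Algebra F⟮X⟯ K] [IsScalarTower F F⟮X⟯ K]
    [FunctionField F K] {z : K} (hz : Transcendental F z) :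
    FiniteDimensional (IntermediateField.adjoin F {z}) K := by
  classical
  set T : K := algebraMap F⟮X⟯ K RatFunc.X with hT
  -- `K` is finite over the field generated by `z` and `T`
  have hX : IsTranscendenceBasis F (fun _ : Unit => T) := by
    have : Algebra.IsAlgebraic (Polynomial F) F⟮X⟯ :=
      IsLocalization.isAlgebraic F⟮X⟯ (nonZeroDivisors (Polynomial F))
    simpa [Function.comp_def] using
      ((IsTranscendenceBasis.polynomial Unit F).algebraMap_comp (A := F⟮X⟯)).algebraMap_comp (A := K)
  have hb : IsTranscendenceBasis F (fun _ : Unit => z) :=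
    AlgebraicIndependent.isTranscendenceBasis_of_lift_trdeg_le_of_finite
      ((algebraicIndependent_unique_type_iff).2 hz) hX.lift_cardinalMk_eq_trdeg.ge
  have halg := hb.isAlgebraic_field
  have hset : Set.range (fun _ : Unit => z) = {z} := Set.range_const
  rw [hset] at halg
  set E := IntermediateField.adjoin F {z} with hE
  let b := Module.finBasis F⟮X⟯ K
  let S : Set K := insert T (Set.range b)
  have hS : Finite S := (Set.finite_range b).insert T
  have hfin : FiniteDimensional E (IntermediateField.adjoin E S) :=
    IntermediateField.finiteDimensional_adjoin fun x _ => (halg.isAlgebraic x).isIntegral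
  have htop : IntermediateField.adjoin E S = ⊤ := by
    rw [eq_top_iff]
    rintro x -
    rw [← b.sum_repr x]
    refine sum_mem fun i _ => ?_
    rw [Algebra.smul_def]
    refine mul_mem ?_ (IntermediateField.subset_adjoin _ _ (Set.mem_insert_of_mem _ ⟨i, rfl⟩))
    have hsub : (algebraMap F⟮X⟯ K).fieldRange ≤ (IntermediateField.adjoin E S).toSubfield := by
      rintro _ ⟨r, rfl⟩
      have hpol : ∀ p : Polynomial F, algebraMap F⟮X⟯ K (algebraMap (Polynomial F) F⟮X⟯ p) ∈
          IntermediateField.adjoin E S := fun p => by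
        induction p using Polynomial.induction_on' with
        | add p q hp hq => rw [map_add, map_add]; exact add_mem hp hq
        | monomial n a =>
          rw [← Polynomial.C_mul_X_pow_eq_monomial]
          simp only [map_mul, map_pow, RatFunc.algebraMap_X]
          refine mul_mem ?_ (pow_mem
            (IntermediateField.subset_adjoin _ _ (Set.mem_insert _ _)) n)
          rw [RatFunc.algebraMap_C, ← RatFunc.algebraMap_eq_C,
            ← IsScalarTower.algebraMap_apply F F⟮X⟯ K]
          exact (IntermediateField.adjoin E S).algebraMap_mem (algebraMap F E a)
      rw [← RatFunc.num_div_denom r, map_div₀]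
      exact div_mem (hpol _) (hpol _)
    exact hsub ⟨_, rfl⟩
  rw [htop] at hfin
  exact IntermediateField.topEquiv.toLinearEquiv.finiteDimensional

/-- If `M` is stable under `z`, then elements of `M` which are linearly independent modulo `z M`
over `F` are linearly independent over `F(z)`. -/
theorem linearIndependent_adjoin_of_mod {z : K} (hz0 : z ≠ 0) (M : Submodule F K)
    (hM : ∀ x ∈ M, z * x ∈ M) {ι : Type*} (x : ι → K) (hx : ∀ i, x i ∈ M)
    (hlin : ∀ (s : Finset ι) (c : ι → F), (∃ y ∈ M, ∑ i ∈ s, c i • x i = z * y) → ∀ i ∈ s, c i = 0) :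
    LinearIndependent (IntermediateField.adjoin F {z}) x := by
  open scoped IntermediateField.algebraAdjoinAdjoin in
  rw [← LinearIndependent.iff_fractionRing (Algebra.adjoin F {z}) (IntermediateField.adjoin F {z})]
  rw [linearIndependent_iff']
  intro s g hg
  have hp : ∀ i, ∃ p : Polynomial F, Polynomial.aeval z p = (g i : K) := fun i => by
    exact (Algebra.adjoin_singleton_eq_range_aeval F z).le (g i).2
  choose p hp using hp
  -- Descent: modulo zM a relation involves only the constant terms of its coefficients, so these
  -- vanish; dividing by z gives a relation of the same kind. Hence every coefficient is divisible
  -- by all powers of X.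
  have key : ∀ (n : ℕ) (p : ι → Polynomial F), ∑ i ∈ s, Polynomial.aeval z (p i) * x i = 0 →
      ∀ i ∈ s, Polynomial.X ^ n ∣ p i := by
    have hmul : ∀ (r : Polynomial F), ∀ y ∈ M, Polynomial.aeval z r * y ∈ M := by
      intro r y hy
      induction r using Polynomial.induction_on' with
      | add p q hp hq => rw [map_add, add_mul]; exact M.add_mem hp hq
      | monomial n a =>
        rw [Polynomial.aeval_monomial, mul_assoc, ← Algebra.smul_def]
        refine M.smul_mem _ ?_
        induction n with
        | zero => simpa
        | succ n ih => rw [pow_succ', mul_assoc]; exact hM _ ih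
    intro n
    induction n with
    | zero => simp
    | succ n ih =>
      intro p hp i hi
      have hdec : ∀ i, Polynomial.aeval z (p i) * x i =
          z * (Polynomial.aeval z (p i).divX * x i) + (p i).coeff 0 • x i := fun i => by
        conv_lhs => rw [← Polynomial.divX_mul_X_add (p i)]
        simp [Algebra.smul_def]
        ring
      have h0 : ∀ i ∈ s, (p i).coeff 0 = 0 := by
        refine hlin s _ ⟨-∑ i ∈ s, Polynomial.aeval z (p i).divX * x i,
          M.neg_mem (sum_mem fun i _ => hmul _ _ (hx i)), ?_⟩
        simp_rw [hdec, Finset.sum_add_distrib, ← Finset.mul_sum] at hp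
        linear_combination hp
      have h1 := ih (fun i => (p i).divX) (by
        rw [Finset.sum_congr rfl fun i _ => hdec i, Finset.sum_add_distrib, ← Finset.mul_sum,
          Finset.sum_eq_zero (f := fun i => (p i).coeff 0 • x i)
            fun i hi => by rw [h0 i hi, zero_smul], add_zero] at hp
        exact (mul_eq_zero.1 hp).resolve_left hz0) i hi
      rw [← Polynomial.divX_mul_X_add (p i), h0 i hi, map_zero, add_zero, pow_succ]
      exact mul_dvd_mul_right h1 _
  intro i hi
  have h0 : p i = 0 := by
    ext n
    exact Polynomial.X_pow_dvd_iff.1 (key (n + 1) p (by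
      simpa [hp, Algebra.smul_def] using hg) i hi) n n.lt_succ_self
  have := hp i
  rw [h0, map_zero] at this
  exact Subtype.ext this.symm

/-- The index in an `F[z]`-submodule `M` of `K` of a subspace that contains `z M` is at most `|F| ^ [K : F(z)]`. -/
theorem relIndex_mul_le [Finite F] {z : K} (hz0 : z ≠ 0)
    [FiniteDimensional (IntermediateField.adjoin F {z}) K] (M N : Submodule F K)
    (hM : ∀ x ∈ M, z * x ∈ M) (hN : ∀ x ∈ M, z * x ∈ N) :
    N.toAddSubgroup.relIndex M.toAddSubgroup ≠ 0 ∧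
    N.toAddSubgroup.relIndex M.toAddSubgroup ≤
      Nat.card F ^ Module.finrank (IntermediateField.adjoin F {z}) K := by
  set Q := M ⧸ N.submoduleOf M
  -- An infinite index has `relIndex` 0, so the first conjunct says that the index is finite.
  have hcard : N.toAddSubgroup.relIndex M.toAddSubgroup = Nat.card Q := rfl
  have hrank : Module.rank F Q ≤ (Module.finrank (IntermediateField.adjoin F {z}) K : ℕ) := by
    refine rank_le fun s hs => ?_
    choose x hx using fun i : s => Submodule.Quotient.mk_surjective _ (i : Q)
    have := linearIndependent_adjoin_of_mod hz0 M hM (fun i => (x i : K)) (fun i => (x i).2) ?_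
    · simpa using this.fintype_card_le_finrank
    · rintro t c ⟨y, hy, hyz⟩
      refine linearIndependent_iff'.1 hs t c ?_
      have hmk : ∑ i ∈ t, c i • (i : Q) = (N.submoduleOf M).mkQ (∑ i ∈ t, c i • x i) := by
        rw [map_sum]
        exact Finset.sum_congr rfl fun i _ => by rw [map_smul, Submodule.mkQ_apply, hx]
      rw [hmk, Submodule.mkQ_apply, Submodule.Quotient.mk_eq_zero]
      change ((∑ i ∈ t, c i • x i : M) : K) ∈ N
      have hsum : ((∑ i ∈ t, c i • x i : M) : K) = z * y := by simpa using hyz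
      rw [hsum]
      exact hN y hy
  have hfin : Module.Finite F Q := Module.rank_lt_aleph0_iff.1 (hrank.trans_lt Cardinal.natCast_lt_aleph0)
  have hfinQ : Finite Q := Module.finite_of_finite F
  rw [hcard]
  refine ⟨Nat.card_pos.ne', ?_⟩
  rw [Module.natCard_eq_pow_finrank (K := F)]
  exact Nat.pow_le_pow_right Nat.card_pos (Module.finrank_le_of_rank_le hrank)

/-! ### Places and weak approximation -/

namespace Place

theorem valuation_eq_exp (v : Place F K) {x : K} (hx : x ≠ 0) :
    v.valuation x = exp (-v.ord x) := by
  rw [ord, neg_neg, exp_log ((Valuation.ne_zero_iff _).2 hx)]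

theorem ord_mul (v : Place F K) {x y : K} (hx : x ≠ 0) (hy : y ≠ 0) :
    v.ord (x * y) = v.ord x + v.ord y := by
  rw [ord, ord, ord, map_mul, log_mul ((Valuation.ne_zero_iff _).2 hx)
    ((Valuation.ne_zero_iff _).2 hy), neg_add]

theorem ord_inv (v : Place F K) (x : K) : v.ord x⁻¹ = -v.ord x := by
  rw [ord, ord, map_inv₀, log_inv]

theorem valuation_le_exp_iff (v : Place F K) {x : K} (hx : x ≠ 0) {n : ℤ} :
    v.valuation x ≤ exp n ↔ -n ≤ v.ord x := by
  rw [v.valuation_eq_exp hx, exp_le_exp, neg_le]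

theorem valuation_lt_one_iff (v : Place F K) {x : K} (hx : x ≠ 0) :
    v.valuation x < 1 ↔ 0 < v.ord x := by
  rw [v.valuation_eq_exp hx, ← exp_zero, exp_lt_exp, neg_lt_zero]

/-- A place is determined by the functions that vanish at it. -/
theorem eq_of_lt_one_iff {v w : Place F K}
    (h : ∀ x, v.valuation x < 1 ↔ w.valuation x < 1) : v = w := by
  have hlt : ∀ x, x ≠ 0 → (0 < v.ord x ↔ 0 < w.ord x) := fun x hx => by
    rw [← valuation_lt_one_iff v hx, ← valuation_lt_one_iff w hx, h]
  obtain ⟨π, hπ⟩ := v.normalized (exp (-1))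
  have hπ0 : π ≠ 0 := by rintro rfl; exact exp_ne_zero (hπ.symm.trans (map_zero _))
  have hvπ : v.ord π = 1 := by rw [ord, hπ, log_exp]; rfl
  obtain ⟨ϖ, hϖ⟩ := w.normalized (exp (-1))
  have hϖ0 : ϖ ≠ 0 := by rintro rfl; exact exp_ne_zero (hϖ.symm.trans (map_zero _))
  have hwϖ : w.ord ϖ = 1 := by rw [ord, hϖ, log_exp]; rfl
  have hunit : ∀ x, x ≠ 0 → v.ord x = 0 → w.ord x = 0 := fun x hx h0 => by
    have h1 := hlt x hx
    have h2 := hlt x⁻¹ (inv_ne_zero hx)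
    rw [ord_inv, ord_inv] at h2
    omega
  have hzpow : ∀ (u : Place F K) (x : K) (n : ℤ), u.ord (x ^ n) = n * u.ord x := fun u x n => by
    rw [ord, ord, map_zpow₀, log_zpow]; simp
  -- x π^(-v(x)) is a unit at v, hence at w; so w is w(π) times v, and normalization of w forces
  -- w(π) = 1.
  have hmul : ∀ x, x ≠ 0 → w.ord x = v.ord x * w.ord π := fun x hx => by
    have := hunit (x * π ^ (-v.ord x)) (mul_ne_zero hx (zpow_ne_zero _ hπ0)) (by
      rw [ord_mul _ hx (zpow_ne_zero _ hπ0), hzpow, hvπ]; ring)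
    rw [ord_mul _ hx (zpow_ne_zero _ hπ0), hzpow] at this
    linarith
  have hwπ : w.ord π = 1 := by
    have h1 := hmul ϖ hϖ0
    rw [hwϖ] at h1
    have h2 := (hlt π hπ0).1 (by omega)
    exact Int.eq_one_of_mul_eq_one_left h2.le h1.symm
  refine Place.ext (Valuation.ext fun x => ?_)
  rcases eq_or_ne x 0 with rfl | hx
  · simp
  · rw [valuation_eq_exp _ hx, valuation_eq_exp _ hx, hmul x hx, hwπ, mul_one]

/-- The real absolute value attached to a place. -/
def absoluteValue (v : Place F K) : AbsoluteValue K ℝ where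
  toFun x := WithZeroMulInt.toNNReal (e := 2) two_ne_zero (v.valuation x)
  map_mul' x y := by simp
  nonneg' x := NNReal.coe_nonneg _
  eq_zero' x := by simp
  add_le' x y := by
    have hmono := (WithZeroMulInt.toNNReal_strictMono (e := 2) one_lt_two).monotone
    rw [← NNReal.coe_add, NNReal.coe_le_coe]
    refine (hmono (v.valuation.map_add x y)).trans ?_
    rw [hmono.map_max]
    exact max_le (le_add_of_nonneg_right zero_le) (le_add_of_nonneg_left zero_le)

theorem absoluteValue_lt_one_iff (v : Place F K) (x : K) :
    v.absoluteValue x < 1 ↔ v.valuation x < 1 := by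
  have := (WithZeroMulInt.toNNReal_strictMono (e := 2) one_lt_two).lt_iff_lt
    (a := v.valuation x) (b := 1)
  rw [map_one] at this
  rw [← this, ← NNReal.coe_lt_coe]
  rfl

theorem one_lt_absoluteValue_iff (v : Place F K) (x : K) :
    1 < v.absoluteValue x ↔ 1 < v.valuation x := by
  have := (WithZeroMulInt.toNNReal_strictMono (e := 2) one_lt_two).lt_iff_lt
    (a := 1) (b := v.valuation x)
  rw [map_one] at this
  rw [← this, ← NNReal.coe_lt_coe]
  rfl

/-- Weak approximation: for a place `v` in a finite set there is a function with a pole at `v` and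
zeros at the other places of the set. -/
theorem exists_pole_and_zeros (S : Finset (Place F K)) {v : Place F K} (hv : v ∈ S) :
    ∃ b : K, 1 < v.valuation b ∧ ∀ w ∈ S, w ≠ v → w.valuation b < 1 := by
  have hnt : ∀ w : S, w.1.absoluteValue.IsNontrivial := by
    rintro ⟨w, -⟩
    obtain ⟨π, hπ⟩ := w.normalized (exp (-1))
    have hlt : w.valuation π < 1 := by rw [hπ, ← exp_zero, exp_lt_exp]; decide
    refine ⟨π, ?_, ((w.absoluteValue_lt_one_iff π).2 hlt).ne⟩
    rintro rfl
    exact exp_ne_zero (hπ.symm.trans (map_zero _))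
  have hpair : Pairwise fun w w' : S => ¬w.1.absoluteValue.IsEquiv w'.1.absoluteValue := by
    intro w w' hne h
    refine hne (Subtype.ext (eq_of_lt_one_iff fun x => ?_))
    rw [← absoluteValue_lt_one_iff, ← absoluteValue_lt_one_iff]
    exact h.lt_one_iff
  obtain ⟨b, hb, hb'⟩ := AbsoluteValue.exists_one_lt_lt_one_pi_of_not_isEquiv hnt hpair ⟨v, hv⟩
  exact ⟨b, (v.one_lt_absoluteValue_iff b).1 hb, fun w hw hne =>
    (w.absoluteValue_lt_one_iff b).1 (hb' ⟨w, hw⟩ fun h => hne (congrArg Subtype.val h))⟩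

/-- Weak approximation: a function regular at one place `v` of a finite set is congruent modulo the
maximal ideal of `v` to a function with prescribed order of vanishing at the other places. -/
theorem exists_approx (S : Finset (Place F K)) {v : Place F K} (hv : v ∈ S) (x : K)
    (hx : v.valuation x ≤ 1) (n : Place F K → ℤ) :
    ∃ y : K, v.valuation (y - x) < 1 ∧ ∀ w ∈ S, w ≠ v → w.valuation y ≤ exp (n w) := by
  rcases eq_or_ne x 0 with rfl | hx0
  · exact ⟨0, by simp, by simp⟩
  obtain ⟨b, hb, hb'⟩ := exists_pole_and_zeros S hv
  -- e is close to 1 at v and vanishes at the other places of S, so e^m x stays congruent to x at v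
  -- and becomes as small as desired elsewhere.
  set e := b / (1 + b) with he
  have hb1 : v.valuation (1 + b) = v.valuation b := by
    rw [add_comm]; exact Valuation.map_add_eq_of_lt_left _ (by simpa using hb)
  have hb10 : 1 + b ≠ 0 := by
    rw [← Valuation.ne_zero_iff v.valuation, hb1]; exact (zero_lt_one.trans hb).ne'
  have hve : v.valuation (e - 1) < 1 := by
    have : e - 1 = -(1 + b)⁻¹ := by rw [he]; field_simp; ring
    rw [this, Valuation.map_neg, map_inv₀, hb1]
    exact inv_lt_one_of_one_lt₀ hb
  have hwe : ∀ w ∈ S, w ≠ v → w.valuation e < 1 := fun w hw hne => by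
    rw [he, map_div₀, Valuation.map_add_eq_of_lt_left _ (by simpa using hb' w hw hne), map_one,
      div_one]
    exact hb' w hw hne
  have hve1 : v.valuation e = 1 := by
    have := Valuation.map_add_eq_of_lt_right v.valuation (x := e - 1) (y := 1) (by simpa using hve)
    simpa using this
  obtain ⟨m, hm⟩ : ∃ m : ℕ, ∀ w ∈ S, -w.ord x - n w ≤ m :=
    ⟨∑ w ∈ S, (-w.ord x - n w).toNat, fun w hw => (Int.self_le_toNat _).trans (by
      exact_mod_cast Finset.single_le_sum (f := fun w : Place F K => (-w.ord x - n w).toNat)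
        (fun _ _ => Nat.zero_le _) hw)⟩
  refine ⟨e ^ m * x, ?_, fun w hw hne => ?_⟩
  · have hpow : v.valuation (e ^ m - 1) < 1 := by
      clear hm
      induction m with
      | zero => simp
      | succ m ih =>
        rw [show e ^ (m + 1) - 1 = e * (e ^ m - 1) + (e - 1) by ring]
        refine Valuation.map_add_lt _ ?_ hve
        rwa [map_mul, hve1, one_mul]
    rw [show e ^ m * x - x = (e ^ m - 1) * x by ring, map_mul]
    exact mul_lt_one_of_lt_of_le hpow hx
  · rw [map_mul, map_pow]
    rcases eq_or_ne e 0 with h0 | h0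
    · rcases Nat.eq_zero_or_pos m with rfl | hm0
      · have := hm w hw
        rw [pow_zero, one_mul, valuation_le_exp_iff _ hx0]
        push_cast at this
        omega
      · simp [h0, hm0.ne']
    · have h1 := (valuation_lt_one_iff w h0).1 (hwe w hw hne)
      have h2 := hm w hw
      rw [valuation_eq_exp _ h0, valuation_eq_exp _ hx0, ← exp_nsmul, ← exp_add, exp_le_exp]
      simp only [nsmul_eq_mul]
      nlinarith
end Place

/-! ### Functions with bounded poles: indices -/

instance isTrivialOn (v : Place F K) : v.valuation.IsTrivialOn F := v.trivialOn

theorem residue_eq_zero_iff (v : Place F K) (x : v.integers) :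
    IsLocalRing.residue v.integers x = 0 ↔ v.valuation x < 1 := by
  rw [IsLocalRing.residue_eq_zero_iff, IsLocalRing.mem_maximalIdeal, mem_nonunits_iff,
    Valuation.Integers.isUnit_iff_valuation_eq_one (Valuation.valuationSubring.integers v.valuation)]
  exact (lt_iff_le_and_ne.trans (and_iff_right x.2)).symm

/-- The functions whose divisor is at least `-D` at the places of `S`. -/
def functionsBounded (S : Set (Place F K)) (D : Divisor F K) : Submodule F K where
  carrier := {x | ∀ v ∈ S, v.valuation x ≤ exp (D v)}
  add_mem' hx hy v hv := (v.valuation.map_add _ _).trans (max_le (hx v hv) (hy v hv))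
  zero_mem' v _ := by simp
  smul_mem' a x hx v hv := by
    rw [Algebra.smul_def, map_mul]
    exact (mul_le_of_le_one_left' (Valuation.IsTrivialOn.valuation_algebraMap_le_one
      (v := v.valuation) a)).trans
      (hx v hv)

theorem mem_functionsBounded {S : Set (Place F K)} {D : Divisor F K} {x : K} :
    x ∈ functionsBounded S D ↔ ∀ v ∈ S, v.valuation x ≤ exp (D v) := Iff.rfl

theorem functionsBounded_mono (S : Set (Place F K)) {D E : Divisor F K} (h : D ≤ E) :
    functionsBounded S D ≤ functionsBounded S E :=
  fun _ hx v hv => (hx v hv).trans (exp_le_exp.2 (h v))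

/-- The leading coefficient at `v` of the functions in `L(D + v)`. -/
theorem exists_leadingCoeff (S : Set (Place F K)) (D : Divisor F K) {v : Place F K} (hv : v ∈ S) :
    ∃ φ : (functionsBounded S (D + Finsupp.single v 1)).toAddSubgroup →+ v.residueField,
      φ.ker = (functionsBounded S D).toAddSubgroup.addSubgroupOf
        (functionsBounded S (D + Finsupp.single v 1)).toAddSubgroup ∧
      (S.Finite → Function.Surjective φ) := by
  classical
  -- t has the largest pole allowed at v, so the residue of x / t is the leading coefficient of x.
  obtain ⟨t, ht⟩ := v.normalized (exp (D v + 1))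
  have ht0 : t ≠ 0 := by rintro rfl; exact exp_ne_zero (ht.symm.trans (map_zero _))
  have hle : ∀ x ∈ functionsBounded S (D + Finsupp.single v 1), x / t ∈ v.integers := fun x hx => by
    have := hx v hv
    rw [Valuation.mem_valuationSubring_iff, map_div₀, ht]
    refine div_le_one_of_le₀ ?_ zero_le
    simpa using this
  let ψ : (functionsBounded S (D + Finsupp.single v 1)).toAddSubgroup →+ v.integers :=
    { toFun := fun x => ⟨x / t, hle x x.2⟩
      map_zero' := by ext; simp
      map_add' := fun x y => by ext; simp [add_div] }
  refine ⟨(IsLocalRing.residue v.integers).toAddMonoidHom.comp ψ, ?_, fun hS y => ?_⟩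
  · ext x
    rw [AddMonoidHom.mem_ker, AddSubgroup.mem_addSubgroupOf]
    have h1 : IsLocalRing.residue v.integers (ψ x) = 0 ↔ v.valuation (x / t) < 1 := by
      rw [residue_eq_zero_iff]
      rfl
    have h2 : v.valuation ((x : K) / t) < 1 ↔ v.valuation x ≤ exp (D v) := by
      rw [map_div₀, ht, div_lt_one₀ (by simp), exp_add, lt_mul_exp_iff_le exp_ne_zero]
    refine (h1.trans h2).trans ⟨fun h w hw => ?_, fun h => h v hv⟩
    rcases eq_or_ne w v with rfl | hne
    · exact h
    · simpa [Finsupp.single_apply, hne.symm] using x.2 w hw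
  · obtain ⟨y, rfl⟩ := IsLocalRing.residue_surjective y
    -- The bounds at w ≠ v are shifted by the order of t, so that x * t satisfies the bound D there.
    obtain ⟨x, hx, hx'⟩ := Place.exists_approx hS.toFinset (by simpa using hv) (y : K) y.2
      (fun w => D w + w.ord t)
    have hvx : v.valuation x ≤ 1 := by
      have := v.valuation.map_add (x - y) y
      rw [sub_add_cancel] at this
      exact this.trans (max_le hx.le y.2)
    refine ⟨⟨x * t, fun w hw => ?_⟩, ?_⟩
    · rcases eq_or_ne w v with rfl | hne
      · rw [map_mul, ht]
        exact (mul_le_of_le_one_left' hvx).trans (by simp)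
      · have := hx' w (by simpa using hw) hne
        rw [map_mul, Place.valuation_eq_exp w ht0]
        refine (mul_le_mul_left this _).trans ?_
        rw [← exp_add]
        simp [hne.symm]
    · change IsLocalRing.residue v.integers _ = _
      rw [← sub_eq_zero, ← map_sub, residue_eq_zero_iff]
      have : x * t / t = x := mul_div_cancel_right₀ x ht0
      change v.valuation (x * t / t - y) < 1
      rwa [this]

/-- The quotient embeds in the residue field by the leading coefficient. This is onto when S is
finite; for all places at once approximation fails and only an inequality remains. -/
theorem relIndex_add_single (S : Set (Place F K)) (D : Divisor F K) {v : Place F K} (hv : v ∈ S) :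
    (S.Finite → (functionsBounded S D).toAddSubgroup.relIndex
      (functionsBounded S (D + Finsupp.single v 1)).toAddSubgroup = Nat.card v.residueField) ∧
    (Finite v.residueField → (functionsBounded S D).toAddSubgroup.relIndex
      (functionsBounded S (D + Finsupp.single v 1)).toAddSubgroup ≠ 0 ∧
      (functionsBounded S D).toAddSubgroup.relIndex
      (functionsBounded S (D + Finsupp.single v 1)).toAddSubgroup ≤ Nat.card v.residueField) := by
  obtain ⟨φ, hker, hsurj⟩ := exists_leadingCoeff S D hv
  rw [AddSubgroup.relIndex, ← hker, AddSubgroup.index_ker]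
  refine ⟨fun hS => ?_, fun hfin => ⟨Nat.card_pos.ne', ?_⟩⟩
  · rw [AddMonoidHom.range_eq_top.2 (hsurj hS)]
    exact AddSubgroup.card_top
  · exact Nat.card_le_card_of_injective _ Subtype.val_injective

/-- Indices multiply along a chain that adds one place at a time, so a relation P compatible with
products passes from single steps to any effective A. It serves for equality (S finite) and for
"finite and at most" (all places). -/
theorem relIndex_add_induction (S : Set (Place F K)) (P : ℕ → ℕ → Prop) (r : Place F K → ℕ)
    (one : P 1 1) (mul : ∀ a b c d, P a b → P c d → P (a * c) (b * d))
    (step : ∀ D : Divisor F K, ∀ v ∈ S, P ((functionsBounded S D).toAddSubgroup.relIndex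
      (functionsBounded S (D + Finsupp.single v 1)).toAddSubgroup) (r v))
    (D A : Divisor F K) (hA : 0 ≤ A) (hAS : ∀ v ∈ A.support, v ∈ S) :
    P ((functionsBounded S D).toAddSubgroup.relIndex (functionsBounded S (D + A)).toAddSubgroup)
      (A.prod fun v n => r v ^ n.toNat) := by
  classical
  have hsingle : ∀ v ∈ S, ∀ (n : ℕ) (D : Divisor F K),
      P ((functionsBounded S D).toAddSubgroup.relIndex
        (functionsBounded S (D + Finsupp.single v (n : ℤ))).toAddSubgroup) (r v ^ n) := by
    intro v hv n
    induction n with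
    | zero => intro D; simpa using one
    | succ n ih =>
      intro D
      have h0 : (0 : Divisor F K) ≤ Finsupp.single v (n : ℤ) := by simp
      have h1 : (0 : Divisor F K) ≤ Finsupp.single v 1 := by simp
      have := mul _ _ _ _ (ih D) (step (D + Finsupp.single v (n : ℤ)) v hv)
      rw [AddSubgroup.relIndex_mul_relIndex] at this
      · rw [pow_succ, Nat.cast_succ, Finsupp.single_add, ← add_assoc]
        exact this
      · exact functionsBounded_mono S (le_add_of_nonneg_right h0)
      · exact functionsBounded_mono S (le_add_of_nonneg_right h1)
  induction A using Finsupp.induction generalizing D with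
  | zero => simpa using one
  | single_add v n A hv hn ih =>
    have hA0 : 0 ≤ A := fun w => by
      have := hA w
      rcases eq_or_ne w v with rfl | hne
      · simp [Finsupp.notMem_support_iff.1 hv]
      · simpa [Finsupp.single_apply, hne.symm] using this
    have hn0 : 0 ≤ n := by
      have := hA v
      simpa [Finsupp.notMem_support_iff.1 hv] using this
    lift n to ℕ using hn0
    have hsupp := Finsupp.support_single_add hv hn
    have hvS : v ∈ S := hAS v (by rw [hsupp]; simp)
    have := mul _ _ _ _ (hsingle v hvS n D) (ih (D + Finsupp.single v (n : ℤ)) hA0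
      (fun w hw => hAS w (by rw [hsupp]; simp [hw])))
    rw [AddSubgroup.relIndex_mul_relIndex] at this
    · rw [Finsupp.prod_add_index_of_disjoint, Finsupp.prod_single_index (by simp), ← add_assoc]
      · exact this
      · rw [Finsupp.support_single _ hn]
        exact Finset.disjoint_singleton_left.2 hv
    · exact functionsBounded_mono S (le_add_of_nonneg_right (by simp))
    · exact functionsBounded_mono S (le_add_of_nonneg_right hA0)

/-! ### Zeros of a function are bounded by [K : F(z)] -/

section
variable [Finite F]

/-- The degree of the zeros of `z` is at most `[K : F(z)]`. -/
theorem sum_ord_mul_deg_le {z : K} (hz0 : z ≠ 0)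
    [FiniteDimensional (IntermediateField.adjoin F {z}) K] (S : Finset (Place F K))
    (hS : ∀ v ∈ S, 0 < v.ord z) :
    (∀ v ∈ S, Finite v.residueField) ∧
    ∑ v ∈ S, v.ord z * v.deg ≤ Module.finrank (IntermediateField.adjoin F {z}) K := by
  classical
  set N := Module.finrank (IntermediateField.adjoin F {z}) K
  -- A is the part of the divisor of zeros supported on S. Multiplication by z sends the functions
  -- regular on S into those bounded by -A, and the index of the latter is the product of
  -- |k(v)|^v(z).
  let A : Divisor F K := Finsupp.indicator S fun v _ => v.ord z
  have hAv : ∀ v ∈ S, A v = v.ord z := fun v hv => Finsupp.indicator_of_mem hv _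
  have hA : 0 ≤ A := fun v => by
    by_cases hv : v ∈ S
    · rw [hAv v hv]; exact (hS v hv).le
    · simp [A, Finsupp.indicator_of_notMem hv]
  have hsupp : A.support = S := by
    ext v
    rw [Finsupp.mem_support_iff]
    by_cases hv : v ∈ S
    · simp [hAv v hv, hv, (hS v hv).ne']
    · simp [A, Finsupp.indicator_of_notMem hv, hv]
  have hind := relIndex_add_induction (S : Set (Place F K)) Eq (fun v => Nat.card v.residueField)
    rfl (fun _ _ _ _ h1 h2 => h1 ▸ h2 ▸ rfl)
    (fun D v hv => (relIndex_add_single _ D hv).1 S.finite_toSet) (-A) A hA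
    (by simp [hsupp])
  rw [neg_add_cancel] at hind
  have hmul : ∀ x ∈ functionsBounded (S : Set (Place F K)) (0 : Divisor F K),
      z * x ∈ functionsBounded (S : Set (Place F K)) (-A) := fun x hx v hv => by
    have := hx v hv
    rw [map_mul, v.valuation_eq_exp hz0, Finsupp.neg_apply, hAv v hv]
    exact mul_le_of_le_one_right' (by simpa using this)
  have hbound := relIndex_mul_le hz0 (functionsBounded (S : Set (Place F K)) (0 : Divisor F K))
    (functionsBounded (S : Set (Place F K)) (-A))
    (fun x hx => functionsBounded_mono _ (neg_nonpos.2 hA) (hmul x hx)) hmul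
  rw [hind, Finsupp.prod, hsupp, Finset.prod_ne_zero_iff] at hbound
  -- An infinite residue field has `Nat.card` 0, which would make the index 0.
  have hfin : ∀ v ∈ S, Finite v.residueField := fun v hv => by
    refine Nat.finite_of_card_ne_zero fun h => hbound.1 v hv ?_
    rw [h, zero_pow]
    have := hS v hv
    rw [hAv v hv]
    omega
  refine ⟨hfin, ?_⟩
  have hcard : ∀ v ∈ S, Nat.card v.residueField ^ (A v).toNat =
      Nat.card F ^ (v.deg * (v.ord z).toNat) := fun v hv => by
    have := hfin v hv
    have : Module.Finite F v.residueField := Module.Finite.of_finite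
    rw [Module.natCard_eq_pow_finrank (K := F), hAv v hv, pow_mul]
    rfl
  have h2 := hbound.2
  rw [Finset.prod_congr rfl hcard, Finset.prod_pow_eq_pow_sum,
    Nat.pow_le_pow_iff_right Finite.one_lt_card] at h2
  calc ∑ v ∈ S, v.ord z * v.deg = ((∑ v ∈ S, v.deg * (v.ord z).toNat : ℕ) : ℤ) := by
        rw [Nat.cast_sum]
        refine Finset.sum_congr rfl fun v hv => ?_
        rw [Nat.cast_mul, Int.toNat_of_nonneg (hS v hv).le, mul_comm]
    _ ≤ N := by exact_mod_cast h2

end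

/-! ### Existence of poles -/

section
variable [Finite F] [Algebra F⟮X⟯ K] [IsScalarTower F F⟮X⟯ K] [FunctionField F K]

/-- Every transcendental function has a pole. -/
theorem exists_one_lt_valuation {z : K} (hz : Transcendental F z) :
    ∃ v : Place F K, 1 < v.valuation z := by
  have hzR : z ∉ (integralClosure F K).toSubring := fun h => hz (IsIntegral.isAlgebraic h)
  -- An integrally closed subring is an intersection of valuation rings; as z is not integral over
  -- F, some valuation ring V omits it. It remains to show that V is discrete.
  have : IsIntegrallyClosedIn (integralClosure F K).toSubring K :=
    inferInstanceAs (IsIntegrallyClosedIn (integralClosure F K) K)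
  obtain ⟨V, hRV, hzV⟩ := Subring.exists_le_valuationSubring_of_isIntegrallyClosedIn hzR
  have halg : ∀ x : K, IsAlgebraic F x → x ∈ V := fun x hx => hRV hx.isIntegral
  let M : Submodule F K :=
    { V.toSubring.toAddSubgroup with
      smul_mem' := fun a x hx => by
        rw [Algebra.smul_def]
        exact V.mul_mem _ _ (halg _ (isAlgebraic_algebraMap a)) hx }
  -- A nonzero nonunit w is transcendental, since V contains all algebraic elements and their
  -- inverses; the index bound for wV in V then applies.
  have hquot : ∀ w : V, w ≠ 0 → ¬IsUnit w → Finite (V ⧸ Ideal.span {w}) := by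
    intro w hw0 hw
    have hw0' : (w : K) ≠ 0 := fun h => hw0 (Subtype.ext h)
    have hwt : Transcendental F (w : K) := fun h => hw <|
      IsUnit.of_mul_eq_one ⟨(w : K)⁻¹, halg _ h.inv⟩ (Subtype.ext (mul_inv_cancel₀ hw0'))
    have := finiteDimensional_adjoin_of_transcendental hwt
    let N : Submodule F K := M.map (LinearMap.mulLeft F (w : K))
    have hne := (relIndex_mul_le hw0' M N (fun x hx => V.mul_mem _ _ w.2 hx)
      (fun x hx => ⟨x, hx, rfl⟩)).1
    let φ : M.toAddSubgroup →+ V ⧸ Ideal.span {w} :=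
      { toFun := fun x => Ideal.Quotient.mk _ ⟨x, x.2⟩
        map_zero' := Ideal.Quotient.eq_zero_iff_mem.2 (Ideal.zero_mem _)
        map_add' := fun x y => (map_add (Ideal.Quotient.mk (Ideal.span {w}))
          ⟨(x : K), x.2⟩ ⟨(y : K), y.2⟩) }
    have hker : N.toAddSubgroup.addSubgroupOf M.toAddSubgroup ≤ φ.ker := by
      rintro x ⟨y, hy, hyx⟩
      refine Ideal.Quotient.eq_zero_iff_mem.2 (Ideal.mem_span_singleton.2 ⟨⟨y, hy⟩, ?_⟩)
      exact Subtype.ext hyx.symm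
    have : Finite (M.toAddSubgroup ⧸ N.toAddSubgroup.addSubgroupOf M.toAddSubgroup) :=
      Nat.finite_of_card_ne_zero hne
    refine Finite.of_surjective (QuotientAddGroup.lift _ φ hker) fun y => ?_
    obtain ⟨y, rfl⟩ := Ideal.Quotient.mk_surjective y
    exact ⟨QuotientAddGroup.mk ⟨(y : K), y.2⟩, rfl⟩
  -- A nonzero proper ideal contains some (w) with V/(w) finite, hence is finitely generated.
  have hnoeth : IsNoetherianRing V := by
    refine ⟨fun I => ?_⟩
    by_cases hI : I = ⊥
    · rw [hI]; exact Submodule.fg_bot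
    obtain ⟨w, hwI, hw0⟩ := Submodule.exists_mem_ne_zero_of_ne_bot hI
    by_cases hw : IsUnit w
    · rw [Ideal.eq_top_of_isUnit_mem I hwI hw]
      exact ⟨{1}, by simp⟩
    have := hquot w hw0 hw
    refine Submodule.fg_of_fg_map_of_fg_inf_ker (Ideal.span {w}).mkQ (IsNoetherian.noetherian _) ?_
    rw [Submodule.ker_mkQ, inf_eq_right.2 ((Ideal.span_singleton_le_iff_mem I).2 hwI)]
    exact ⟨{w}, by simp⟩
  have hz0 : z ≠ 0 := by rintro rfl; exact hzV V.zero_mem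
  have hzinv : z⁻¹ ∈ V := (V.mem_or_inv_mem z).resolve_left hzV
  have hzmax : (⟨z⁻¹, hzinv⟩ : V) ∈ IsLocalRing.maximalIdeal V := by
    rw [IsLocalRing.mem_maximalIdeal, mem_nonunits_iff]
    rintro h
    obtain ⟨u, hu⟩ := h.exists_right_inv
    have hu' : z⁻¹ * (u : K) = 1 := congrArg Subtype.val hu
    have : (u : K) = z := by field_simp at hu'; exact hu'
    exact hzV (this ▸ u.2)
  have hdvr : IsDiscreteValuationRing V :=
    { not_a_field' := fun h => by
        rw [h] at hzmax
        exact inv_ne_zero hz0 (congrArg Subtype.val hzmax) }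
  let P := IsDiscreteValuationRing.maximalIdeal V
  refine ⟨⟨P.valuation K, inferInstance, P.valuation_surjective K⟩, ?_⟩
  have := (P.valuation_lt_one_iff_mem (K := K) ⟨z⁻¹, hzinv⟩).2 hzmax
  change P.valuation K z⁻¹ < 1 at this
  rw [map_inv₀] at this
  exact (inv_lt_one₀ (zero_lt_iff.2 ((Valuation.ne_zero_iff _).2 hz0))).1 this
end

/-- Valuation rings are integrally closed and contain F, so neither x nor x⁻¹ has a pole. For x = 0
the default value of `ord` is 0. -/
theorem ord_eq_zero_of_isAlgebraic (v : Place F K) {x : K} (hx : IsAlgebraic F x) :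
    v.ord x = 0 := by
  rcases eq_or_ne x 0 with rfl | hx0
  · simp [Place.ord]
  have : IsScalarTower F v.integers K := IsScalarTower.of_algebraMap_eq fun _ => rfl
  have hle : ∀ y : K, y ≠ 0 → IsAlgebraic F y → 0 ≤ v.ord y := fun y hy0 hy => by
    have h1 : v.valuation y ≤ 1 :=
      (Valuation.valuationSubring.integers v.valuation).mem_of_integral hy.isIntegral.tower_top
    rw [← exp_zero, v.valuation_le_exp_iff hy0] at h1
    simpa using h1
  have h1 := hle x hx0 hx
  have h2 := hle x⁻¹ (inv_ne_zero hx0) hx.inv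
  rw [Place.ord_inv] at h2
  omega

theorem transcendental_of_ord_ne_zero (v : Place F K) {x : K} (hx : v.ord x ≠ 0) :
    Transcendental F x := fun h => hx (ord_eq_zero_of_isAlgebraic v h)

/-! ### Divisors and Riemann-Roch spaces -/

namespace Divisor

theorem deg_add (D E : Divisor F K) : (D + E).deg = D.deg + E.deg :=
  Finsupp.sum_add_index' (by simp) (fun _ _ _ => add_mul _ _ _)

theorem deg_zero : (0 : Divisor F K).deg = 0 := Finsupp.sum_zero_index

theorem deg_sub (D E : Divisor F K) : (D - E).deg = D.deg - E.deg := by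
  have := deg_add (D - E) E
  rw [sub_add_cancel] at this
  linarith

theorem deg_nsmul (n : ℕ) (D : Divisor F K) : (n • D).deg = n * D.deg := by
  induction n with
  | zero => simp [deg_zero]
  | succ n ih => rw [succ_nsmul, deg_add, ih]; push_cast; ring

theorem deg_single (v : Place F K) (n : ℤ) : Divisor.deg (Finsupp.single v n) = n * v.deg :=
  Finsupp.sum_single_index (by simp)

theorem deg_nonneg {D : Divisor F K} (hD : 0 ≤ D) : 0 ≤ D.deg :=
  Finset.sum_nonneg fun v _ => mul_nonneg (hD v) (Nat.cast_nonneg _)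

end Divisor

/-- The Riemann-Roch space of functions `x` with `(x) ≥ -D`. -/
abbrev riemannRochSpace (D : Divisor F K) : Submodule F K := functionsBounded Set.univ D

theorem mem_riemannRochSpace {D : Divisor F K} {x : K} (hx : x ≠ 0) :
    x ∈ riemannRochSpace D ↔ ∀ v, -D v ≤ v.ord x := by
  simp_rw [riemannRochSpace, mem_functionsBounded, Set.mem_univ, true_imp_iff,
    Place.valuation_le_exp_iff _ hx]

/-- The dimension `ℓ(D)` of the Riemann-Roch space of `D`. -/
def dimension (D : Divisor F K) : ℕ := Module.finrank F (riemannRochSpace D)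

theorem exists_mem_of_dimension_pos {D : Divisor F K} (h : 0 < dimension D) :
    ∃ x : K, x ≠ 0 ∧ ∀ v, -D v ≤ v.ord x := by
  have := Module.nontrivial_of_finrank_pos h
  obtain ⟨x, hx⟩ := exists_ne (0 : riemannRochSpace D)
  have hx0 : (x : K) ≠ 0 := fun h => hx (Subtype.ext h)
  exact ⟨x, hx0, (mem_riemannRochSpace hx0).1 x.2⟩

variable (F K) in
theorem exists_transcendental [Algebra F⟮X⟯ K] [IsScalarTower F F⟮X⟯ K] :
    ∃ z : K, Transcendental F z :=
  ⟨algebraMap F⟮X⟯ K RatFunc.X,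
    (transcendental_algebraMap_iff (algebraMap F⟮X⟯ K).injective).2 RatFunc.transcendental_X⟩

section
variable [Finite F] [Algebra F⟮X⟯ K] [IsScalarTower F F⟮X⟯ K] [FunctionField F K]

/-- A uniformizer at v is transcendental, and the bound on its zeros includes finiteness of their
residue fields. -/
instance finite_residueField (v : Place F K) : Finite v.residueField := by
  obtain ⟨π, hπ⟩ := v.normalized (exp (-1))
  have h1 : v.ord π = 1 := by rw [Place.ord, hπ, log_exp]; rfl
  have hπ0 : π ≠ 0 := by rintro rfl; exact exp_ne_zero (hπ.symm.trans (map_zero _))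
  have := finiteDimensional_adjoin_of_transcendental
    (transcendental_of_ord_ne_zero v (x := π) (by omega))
  exact (sum_ord_mul_deg_le hπ0 {v} (by simp [h1])).1 v (by simp)

instance moduleFinite_residueField (v : Place F K) : Module.Finite F v.residueField :=
  Module.Finite.of_finite

theorem deg_pos (v : Place F K) : 0 < v.deg := Module.finrank_pos

theorem finite_setOf_ord_pos (z : K) : {v : Place F K | 0 < v.ord z}.Finite := by
  by_cases hz : IsAlgebraic F z
  · convert Set.finite_empty
    ext v
    simp [ord_eq_zero_of_isAlgebraic v hz]
  have := finiteDimensional_adjoin_of_transcendental hz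
  have hz0 : z ≠ 0 := by rintro rfl; exact hz isAlgebraic_zero
  by_contra hinf
  obtain ⟨S, hS, hcard⟩ := Set.Infinite.exists_subset_card_eq hinf
    (Module.finrank (IntermediateField.adjoin F {z}) K + 1)
  have h1 := (sum_ord_mul_deg_le hz0 S hS).2
  have h2 : (S.card : ℤ) ≤ ∑ v ∈ S, v.ord z * v.deg := by
    rw [Finset.card_eq_sum_ones, Nat.cast_sum]
    refine Finset.sum_le_sum fun v hv => ?_
    have h3 : 0 < v.ord z := hS hv
    have h4 := deg_pos v
    rw [Nat.cast_one]
    exact Int.add_one_le_of_lt (mul_pos h3 (by exact_mod_cast h4))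
  omega

/-- The divisor of zeros of a function. -/
def zeros (z : K) : Divisor F K :=
  Finsupp.ofSupportFinite (fun v => max (v.ord z) 0) <|
    (finite_setOf_ord_pos z).subset fun v hv => by
      rw [Function.mem_support] at hv
      change 0 < v.ord z
      by_contra h
      exact hv (max_eq_right (not_lt.1 h))

theorem zeros_apply (z : K) (v : Place F K) : zeros z v = max (v.ord z) 0 := rfl

theorem zeros_nonneg (z : K) : (0 : Divisor F K) ≤ zeros z := fun _ => le_max_right _ _

/-- The divisor of a function. -/
def divisor (z : K) : Divisor F K := zeros z - zeros z⁻¹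

theorem divisor_apply (z : K) (v : Place F K) : divisor z v = v.ord z := by
  rw [divisor, Finsupp.sub_apply, zeros_apply, zeros_apply, Place.ord_inv]
  omega

variable (F K) in
theorem nonempty_place : Nonempty (Place F K) :=
  let ⟨_, hz⟩ := exists_transcendental F K
  let ⟨v, _⟩ := exists_one_lt_valuation hz
  ⟨v⟩

theorem prod_card_residueField {A : Divisor F K} (hA : 0 ≤ A) :
    (A.prod fun v n => Nat.card v.residueField ^ n.toNat) = Nat.card F ^ A.deg.toNat := by
  have h : A.deg = ((∑ v ∈ A.support, v.deg * (A v).toNat : ℕ) : ℤ) := by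
    rw [Nat.cast_sum]
    refine Finset.sum_congr rfl fun v _ => ?_
    rw [Nat.cast_mul, Int.toNat_of_nonneg (hA v), mul_comm]
  rw [h, Int.toNat_natCast, ← Finset.prod_pow_eq_pow_sum, Finsupp.prod]
  refine Finset.prod_congr rfl fun v _ => ?_
  rw [Module.natCard_eq_pow_finrank (K := F), pow_mul]
  rfl

theorem relIndex_riemannRochSpace (D : Divisor F K) {A : Divisor F K} (hA : 0 ≤ A) :
    (riemannRochSpace D).toAddSubgroup.relIndex (riemannRochSpace (D + A)).toAddSubgroup ≠ 0 ∧
    (riemannRochSpace D).toAddSubgroup.relIndex (riemannRochSpace (D + A)).toAddSubgroup ≤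
      Nat.card F ^ A.deg.toNat := by
  rw [← prod_card_residueField hA]
  exact relIndex_add_induction Set.univ (fun a b => a ≠ 0 ∧ a ≤ b) _ ⟨one_ne_zero, le_rfl⟩
    (fun _ _ _ _ h1 h2 => ⟨mul_ne_zero h1.1 h2.1, Nat.mul_le_mul h1.2 h2.2⟩)
    (fun D v hv => (relIndex_add_single _ D hv).2 inferInstance) D A hA (by simp)

/-- L(-v) = 0: a nonzero function vanishing at v is transcendental, so it has a pole. Effective
enlargements have finite index over this zero space. -/
instance finite_riemannRochSpace (D : Divisor F K) : Finite (riemannRochSpace D) := by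
  obtain ⟨v⟩ := nonempty_place F K
  have hbot : riemannRochSpace (-Finsupp.single v 1 : Divisor F K) = ⊥ := by
    rw [eq_bot_iff]
    intro x hx
    by_contra hx0
    rw [mem_riemannRochSpace hx0] at hx
    have hv := hx v
    simp only [Finsupp.neg_apply, Finsupp.single_eq_same, neg_neg] at hv
    obtain ⟨w, hw⟩ := exists_one_lt_valuation
      (transcendental_of_ord_ne_zero v (x := x) (by omega))
    have h1 := hx w
    have h2 : (0 : ℤ) ≤ Finsupp.single v (1 : ℤ) w := by
      have : (0 : Divisor F K) ≤ Finsupp.single v 1 := by simp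
      exact this w
    rw [Finsupp.neg_apply, neg_neg] at h1
    refine hw.not_ge ?_
    rw [← exp_zero, Place.valuation_le_exp_iff _ hx0]
    omega
  have hle : -Finsupp.single v 1 ≤ D ⊔ 0 := le_trans (by simp) (le_sup_right (a := D))
  have h := (relIndex_riemannRochSpace (-Finsupp.single v 1) (sub_nonneg.2 hle)).1
  rw [hbot, add_sub_cancel] at h
  change (⊥ : AddSubgroup K).relIndex _ ≠ 0 at h
  rw [AddSubgroup.relIndex_bot_left] at h
  have : Finite (riemannRochSpace (D ⊔ 0)) := Nat.finite_of_card_ne_zero h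
  exact Set.Finite.subset (Set.toFinite (riemannRochSpace (D ⊔ 0) : Set K))
    (functionsBounded_mono _ le_sup_left)

instance moduleFinite_riemannRochSpace (D : Divisor F K) :
    Module.Finite F (riemannRochSpace D) := Module.Finite.of_finite

/-- Each L(D) has q^ℓ(D) elements, so the index bound q^deg(E - D) becomes additive in the
exponents. -/
theorem dimension_le {D E : Divisor F K} (h : D ≤ E) :
    (dimension E : ℤ) ≤ dimension D + (E.deg - D.deg) := by
  have hA := sub_nonneg.2 h
  have h1 := (relIndex_riemannRochSpace D hA).2
  rw [add_sub_cancel] at h1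
  have h2 := AddSubgroup.relIndex_mul_relIndex ⊥ (riemannRochSpace D).toAddSubgroup
    (riemannRochSpace E).toAddSubgroup bot_le (functionsBounded_mono _ h)
  rw [AddSubgroup.relIndex_bot_left, AddSubgroup.relIndex_bot_left] at h2
  have hcard : ∀ D : Divisor F K,
      Nat.card (riemannRochSpace D).toAddSubgroup = Nat.card F ^ dimension D := fun D =>
    Module.natCard_eq_pow_finrank (K := F) (V := riemannRochSpace D)
  rw [hcard, hcard] at h2
  have h3 : Nat.card F ^ dimension E ≤ Nat.card F ^ (dimension D + (E - D).deg.toNat) := by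
    rw [← h2, pow_add]
    exact Nat.mul_le_mul_left _ h1
  rw [Nat.pow_le_pow_iff_right Finite.one_lt_card] at h3
  have h4 := Divisor.deg_nonneg hA
  rw [← Divisor.deg_sub]
  omega

end

/-! ### The degree of a principal divisor -/

theorem adjoin_inv (z : K) :
    IntermediateField.adjoin F {z⁻¹} = IntermediateField.adjoin F {z} := by
  refine le_antisymm (IntermediateField.adjoin_simple_le_iff.2 (inv_mem
    (IntermediateField.mem_adjoin_simple_self F z))) (IntermediateField.adjoin_simple_le_iff.2 ?_)
  have := inv_mem (IntermediateField.mem_adjoin_simple_self F z⁻¹)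
  rwa [inv_inv] at this

section
variable [Finite F] [Algebra F⟮X⟯ K] [IsScalarTower F F⟮X⟯ K] [FunctionField F K]

/-- Lower bound for the dimension of the multiples of the divisor of poles of `z`. -/
theorem exists_le_dimension_nsmul_poles {z : K} (hz : Transcendental F z) :
    ∃ c : ℕ, ∀ l : ℕ, Module.finrank (IntermediateField.adjoin F {z}) K * (l + 1) ≤
      dimension (l • zeros z⁻¹ : Divisor F K) + c := by
  have := finiteDimensional_adjoin_of_transcendental hz
  have hz0 : z ≠ 0 := by rintro rfl; exact hz isAlgebraic_zero
  set E := IntermediateField.adjoin F {z}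
  set N := Module.finrank E K
  let u : Module.Basis (Fin N) E K := Module.finBasis E K
  -- C absorbs the poles of the basis u, so the N(l + 1) independent functions z^j u_i with j ≤ l
  -- lie in L(lP + C), P being the polar divisor of z. Returning to L(lP) costs at most deg C,
  -- whatever l is.
  let C : Divisor F K := ∑ i, zeros (u i)⁻¹
  have hC : 0 ≤ C := Finset.sum_nonneg fun i _ => zeros_nonneg _
  refine ⟨C.deg.toNat, fun l => ?_⟩
  let zE : E := IntermediateField.AdjoinSimple.gen F z
  have hzE : Transcendental F zE := fun h => hz <| by
    simpa [zE] using h.algebraMap (A := K)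
  have hpow : LinearIndependent F fun j : Fin (l + 1) => zE ^ (j : ℕ) := by
    have := ((Polynomial.basisMonomials F).linearIndependent.map'
      (Polynomial.aeval zE).toLinearMap (LinearMap.ker_eq_bot.2
        (transcendental_iff_injective.1 hzE))).comp _ (Fin.val_injective (n := l + 1))
    simpa [Function.comp_def, Polynomial.aeval_monomial] using this
  have hlin := linearIndependent_smul hpow u.linearIndependent
  have hmem : ∀ p : Fin (l + 1) × Fin N, zE ^ (p.1 : ℕ) • u p.2 ∈
      riemannRochSpace (l • zeros z⁻¹ + C) := by
    rintro ⟨j, i⟩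
    have hu0 : u i ≠ 0 := u.ne_zero i
    have hval : zE ^ (j : ℕ) • u i = z ^ (j : ℕ) * u i := by
      rw [Algebra.smul_def, map_pow]; rfl
    rw [hval, mem_riemannRochSpace (mul_ne_zero (pow_ne_zero _ hz0) hu0)]
    intro v
    have h1 : v.ord (z ^ (j : ℕ)) = j * v.ord z := by
      rw [Place.ord, Place.ord, map_pow, log_pow]; simp
    have h2 : zeros (u i)⁻¹ v ≤ C v := by
      rw [Finsupp.finsetSum_apply]
      exact Finset.single_le_sum (f := fun i => zeros (u i)⁻¹ v)
        (fun i _ => zeros_nonneg _ v) (Finset.mem_univ i)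
    rw [zeros_apply, Place.ord_inv] at h2
    rw [Place.ord_mul _ (pow_ne_zero _ hz0) hu0, h1, Finsupp.add_apply, Finsupp.smul_apply,
      zeros_apply, Place.ord_inv, nsmul_eq_mul]
    have h3 : (j : ℤ) ≤ l := by exact_mod_cast Nat.lt_succ_iff.1 j.2
    have h4 : -((j : ℤ) * v.ord z) ≤ l * max (-v.ord z) 0 := by
      have h5 := le_max_left (-v.ord z) 0
      have h6 := le_max_right (-v.ord z) 0
      have h7 : (0 : ℤ) ≤ j := Int.natCast_nonneg _
      nlinarith
    have h8 := le_max_left (-v.ord (u i)) 0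
    linarith
  let f : Fin (l + 1) × Fin N → riemannRochSpace (l • zeros z⁻¹ + C) := fun p => ⟨_, hmem p⟩
  have hf : LinearIndependent F f :=
    LinearIndependent.of_comp (riemannRochSpace (l • zeros z⁻¹ + C)).subtype hlin
  have h1 := hf.fintype_card_le_finrank
  rw [Fintype.card_prod, Fintype.card_fin, Fintype.card_fin] at h1
  have h2 := dimension_le (D := l • zeros z⁻¹) (E := l • zeros z⁻¹ + C)
    (le_add_of_nonneg_right hC)
  rw [Divisor.deg_add] at h2
  have h3 := Divisor.deg_nonneg hC
  have h4 : (l + 1) * N ≤ dimension (l • zeros z⁻¹ + C) := h1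
  rw [mul_comm]
  omega

/-- The divisor of zeros of a transcendental function `z` has degree `[K : F(z)]`. -/
theorem deg_zeros {z : K} (hz : Transcendental F z) :
    (zeros z : Divisor F K).deg = Module.finrank (IntermediateField.adjoin F {z}) K := by
  have hz0 : z ≠ 0 := by rintro rfl; exact hz isAlgebraic_zero
  have hfin := finiteDimensional_adjoin_of_transcendental hz
  refine le_antisymm ?_ ?_
  · have hpos : ∀ v ∈ (zeros z : Divisor F K).support, 0 < v.ord z := fun v hv => by
      rw [Finsupp.mem_support_iff, zeros_apply] at hv
      by_contra h
      exact hv (max_eq_right (not_lt.1 h))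
    refine le_trans (le_of_eq ?_) (sum_ord_mul_deg_le hz0 _ hpos).2
    refine Finset.sum_congr rfl fun v hv => ?_
    rw [zeros_apply, max_eq_left (hpos v hv).le]
  · obtain ⟨c, hc⟩ := exists_le_dimension_nsmul_poles (z := z⁻¹) (fun h => hz (by simpa using h.inv))
    rw [adjoin_inv, inv_inv] at hc
    set N := Module.finrank (IntermediateField.adjoin F {z}) K
    by_contra hlt
    -- If deg (zeros z) ≤ N - 1, then N(l + 1) ≤ l(N - 1) + ℓ(0) + c; this l makes the right side
    -- lN, a contradiction.
    set l := c + dimension (0 : Divisor F K)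
    have h1 := hc l
    have hnn : (0 : Divisor F K) ≤ l • zeros z := nsmul_nonneg (zeros_nonneg z) l
    have h2 := dimension_le hnn
    rw [Divisor.deg_zero, Divisor.deg_nsmul] at h2
    have h3 : (zeros z : Divisor F K).deg + 1 ≤ N := Int.add_one_le_of_lt (not_le.1 hlt)
    have h4 : (N : ℤ) * (l + 1) ≤ dimension (l • zeros z : Divisor F K) + c := by exact_mod_cast h1
    have h5 : (l : ℤ) = c + dimension (0 : Divisor F K) := by simp [l]
    have h6 := Divisor.deg_nonneg (zeros_nonneg (F := F) z)
    nlinarith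

/-- Principal divisors have degree zero. -/
theorem deg_divisor (z : K) : (divisor z : Divisor F K).deg = 0 := by
  by_cases hz : IsAlgebraic F z
  · have : (divisor z : Divisor F K) = 0 := by
      ext v
      rw [divisor_apply, ord_eq_zero_of_isAlgebraic v hz]
      rfl
    rw [this, Divisor.deg_zero]
  · rw [divisor, Divisor.deg_sub, deg_zeros hz, deg_zeros fun h => hz (by simpa using h.inv),
      adjoin_inv, sub_self]

theorem divisor_mem_principalDivisors {z : K} (hz : z ≠ 0) :
    divisor z ∈ principalDivisors F K :=
  ⟨z, hz, divisor_apply z⟩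

theorem deg_eq_zero_of_mem_principalDivisors {D : Divisor F K} (hD : D ∈ principalDivisors F K) :
    D.deg = 0 := by
  obtain ⟨z, -, hz⟩ := hD
  rw [show D = divisor z from Finsupp.ext fun v => by rw [hz, divisor_apply], deg_divisor]

/-! ### Effective representatives in large degree -/

variable (F K) in
/-- A weak form of Riemann's inequality: divisors of large degree are linearly equivalent to
effective ones. -/
theorem exists_effective_of_deg_ge : ∃ c : ℤ, ∀ D : Divisor F K, c ≤ D.deg →
    ∃ E : Divisor F K, 0 ≤ E ∧ E - D ∈ principalDivisors F K := by
  obtain ⟨T, hT⟩ := exists_transcendental F K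
  have hTinv : Transcendental F T⁻¹ := fun h => hT (by simpa using h.inv)
  have hfin := finiteDimensional_adjoin_of_transcendental hT
  obtain ⟨c, hc⟩ := exists_le_dimension_nsmul_poles hT
  set N := Module.finrank (IntermediateField.adjoin F {T}) K with hN
  have hNpos : 0 < N := Module.finrank_pos
  set P : Divisor F K := zeros T⁻¹ with hP
  have hdegP : P.deg = N := by rw [hP, deg_zeros hTinv, adjoin_inv]
  refine ⟨c, fun D hD => ?_⟩
  have hnonneg : 0 ≤ (D ⊔ 0).deg := Divisor.deg_nonneg le_sup_right
  -- With D⁺ = D ⊔ 0, this l gives ℓ(lP - D⁺) ≥ N(l + 1) - c - deg D⁺ ≥ 1. A nonzero z in that space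
  -- replaces D by the equivalent divisor D - (z) ≤ lP.
  set l := c + (D ⊔ 0).deg.toNat with hl
  have hcl : (N : ℤ) * (l + 1) ≤ dimension (l • P) + c := by exact_mod_cast hc l
  have hdim1 : 0 < dimension (l • P - (D ⊔ 0)) := by
    have h1 := dimension_le (D := l • P - (D ⊔ 0)) (E := l • P) (sub_le_self _ le_sup_right)
    rw [Divisor.deg_sub] at h1
    have h2 : (l : ℤ) = c + (D ⊔ 0).deg := by rw [hl, Nat.cast_add, Int.toNat_of_nonneg hnonneg]
    have h3 : (l : ℤ) + 1 ≤ N * (l + 1) :=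
      le_mul_of_one_le_left (by positivity) (by exact_mod_cast hNpos)
    omega
  obtain ⟨z, hz0, hz⟩ := exists_mem_of_dimension_pos hdim1
  have hle : D - divisor z ≤ l • P := fun v => by
    have h1 := hz v
    have h2 : D v ≤ (D ⊔ 0) v := (le_sup_left (a := D) (b := 0)) v
    rw [Finsupp.sub_apply] at h1
    rw [Finsupp.sub_apply, divisor_apply]
    linarith
  -- Descending from lP: ℓ(D - (z)) ≥ N(l + 1) - c - (lN - deg D) ≥ N. The dependence on l, hence on
  -- D, cancels.
  have hdim2 : 0 < dimension (D - divisor z) := by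
    have h1 := dimension_le hle
    rw [Divisor.deg_sub, deg_divisor, Divisor.deg_nsmul, hdegP] at h1
    have h2 : (0 : ℤ) < N := by exact_mod_cast hNpos
    have h3 : (0 : ℤ) < dimension (D - divisor z) := by nlinarith
    exact_mod_cast h3
  obtain ⟨y, hy0, hy⟩ := exists_mem_of_dimension_pos hdim2
  refine ⟨D - divisor z + divisor y, fun v => ?_, ?_⟩
  · have h1 := hy v
    rw [Finsupp.add_apply, divisor_apply]
    simp only [Finsupp.coe_zero, Pi.zero_apply]
    linarith
  · rw [show D - divisor z + divisor y - D = divisor y - divisor z by abel]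
    exact sub_mem (divisor_mem_principalDivisors hy0) (divisor_mem_principalDivisors hz0)

/-! ### Finiteness of effective divisors and of Pic(n) -/

/-- There are finitely many places of bounded degree. -/
theorem finite_setOf_deg_le (n : ℕ) : {v : Place F K | v.deg ≤ n}.Finite := by
  obtain ⟨T, hT⟩ := exists_transcendental F K
  have hT0 : T ≠ 0 := by rintro rfl; exact hT isAlgebraic_zero
  -- In a residue field with q^m elements every t satisfies t^(q^m) = t, so w m vanishes at each
  -- place of degree m that is not a pole of T.
  let w : ℕ → K := fun m => T ^ Nat.card F ^ m - T
  have hw0 : ∀ m, 0 < m → w m ≠ 0 := fun m hm h0 => by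
    refine hT ⟨Polynomial.X ^ Nat.card F ^ m - Polynomial.X,
      FiniteField.X_pow_card_pow_sub_X_ne_zero F hm.ne' Finite.one_lt_card, ?_⟩
    simpa using h0
  refine ((finite_setOf_ord_pos T⁻¹).union ((Set.finite_Icc 1 n).biUnion fun m _ =>
    finite_setOf_ord_pos (w m))).subset fun v hv => ?_
  by_cases hpole : 0 < v.ord T⁻¹
  · exact Or.inl hpole
  refine Or.inr (Set.mem_biUnion (x := v.deg) ⟨deg_pos v, hv⟩ ?_)
  have hTv : v.valuation T ≤ 1 := by
    rw [← exp_zero, v.valuation_le_exp_iff hT0]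
    rw [Place.ord_inv] at hpole
    omega
  let t : v.integers := ⟨T, hTv⟩
  have hcard : Nat.card v.residueField = Nat.card F ^ v.deg :=
    Module.natCard_eq_pow_finrank
  have hres : IsLocalRing.residue v.integers (t ^ Nat.card F ^ v.deg - t) = 0 := by
    have := Fintype.ofFinite v.residueField
    rw [map_sub, map_pow, ← hcard, Nat.card_eq_fintype_card, FiniteField.pow_card, sub_self]
  rw [residue_eq_zero_iff] at hres
  exact (v.valuation_lt_one_iff (hw0 _ (deg_pos v))).1 hres

/-- There are finitely many effective divisors of a given degree. -/
theorem finite_effective (n : ℕ) : {D : Divisor F K | 0 ≤ D ∧ D.deg = n}.Finite := by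
  classical
  -- Place degrees are positive, so coefficients are at most n and places of degree above n do not
  -- occur.
  let B : Divisor F K := Finsupp.indicator (finite_setOf_deg_le (F := F) (K := K) n).toFinset
    fun _ _ => (n : ℤ)
  refine (Set.finite_Icc 0 B).subset ?_
  rintro D ⟨hD, hdeg⟩
  refine ⟨hD, fun v => ?_⟩
  have hv : D v * v.deg ≤ n := by
    rw [← hdeg]
    by_cases hv : v ∈ D.support
    · exact Finset.single_le_sum (f := fun v => D v * (v.deg : ℤ))
        (fun w _ => mul_nonneg (hD w) (Nat.cast_nonneg _)) hv
    · rw [Finsupp.notMem_support_iff.1 hv, zero_mul]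
      exact Divisor.deg_nonneg hD
  have hpos : (0 : ℤ) < v.deg := by exact_mod_cast deg_pos v
  have hDv : 0 ≤ D v := hD v
  by_cases hle : v.deg ≤ n
  · have : B v = n := Finsupp.indicator_of_mem (by simpa using hle) _
    rw [this]
    nlinarith
  · have : B v = 0 := Finsupp.indicator_of_notMem (by simpa using hle) _
    rw [this]
    by_contra hlt
    have h1 : (n : ℤ) < v.deg := by exact_mod_cast not_le.1 hle
    nlinarith

variable (F K) in
theorem finite_pic (n : ℤ) : (Pic F K n).Finite := by
  obtain ⟨v⟩ := nonempty_place F K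
  obtain ⟨c, hc⟩ := exists_effective_of_deg_ge F K
  -- The first summand makes n + k deg v at least c; the second makes it nonnegative, hence a
  -- natural number m.
  set k : ℕ := (c - n).toNat + n.natAbs with hk
  have hpos : (1 : ℤ) ≤ v.deg := by exact_mod_cast deg_pos v
  have hkd : (k : ℤ) ≤ k * v.deg := le_mul_of_one_le_right (Int.natCast_nonneg _) hpos
  set A : Divisor F K := Finsupp.single v (k : ℤ) with hA
  have hdegA : A.deg = k * v.deg := Divisor.deg_single v k
  obtain ⟨m, hm⟩ : ∃ m : ℕ, (m : ℤ) = n + k * v.deg :=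
    ⟨(n + k * v.deg).toNat, Int.toNat_of_nonneg (by omega)⟩
  refine Set.Finite.subset ((finite_effective (F := F) (K := K) m).image
    fun E => (QuotientAddGroup.mk (E - A) : DivisorClass F K)) ?_
  rintro _ ⟨D, hD, rfl⟩
  obtain ⟨E, hE, hED⟩ := hc (D + A) (by rw [Divisor.deg_add, hD, hdegA]; omega)
  refine ⟨E, ⟨hE, ?_⟩, ?_⟩
  · have := deg_eq_zero_of_mem_principalDivisors hED
    rw [Divisor.deg_sub, Divisor.deg_add, hD, hdegA] at this
    omega
  · refine ((QuotientAddGroup.eq).2 ?_).symm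
    rwa [show -D + (E - A) = E - (D + A) by abel]

end

end FunctionFieldCurve

end

theorem mainTheorem8 (F K : Type*) [Field F] [Finite F] [Field K] [Algebra F K]
    [Algebra F⟮X⟯ K] [IsScalarTower F F⟮X⟯ K] [FunctionField F K]
    (hconst : algebraicClosure F K = ⊥) :
    (∀ n : ℤ, (FunctionFieldCurve.Pic F K n).Finite) ∧
      FunctionFieldCurve.classNumber F K < ⊤ :=
  ⟨FunctionFieldCurve.finite_pic F K, (FunctionFieldCurve.finite_pic F K 0).encard_lt_top⟩
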